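/- Let $m \ge s \ge 1$ be integers, $x = m/s$ and $n = \lfloor 2x \rfloor$ (so $n \ge 2$). In the supply-constrained muffin problem $(m,s)$, each of $m$ muffins of size $1$ is cut into exactly two pieces of positive size, and the $2m$ pieces are distributed to $s$ students so that each student receives total size $x$; the objective is to maximize the size of the smallest piece. The corresponding fully-constrained muffin problem has the same objective and the additional requirement that every student receives either $n$ or $n+1$ pieces. Then: 1. Every optimal solution of the fully-constrained problem is an optimal solution of the supply-constrained problem. 2. The supply-constrained problem has an optimal solution in which every student receives either $n$ or $n+1$ pieces. 3. The supply-constrained problem has an optimal solution that is not feasible for the fully-constrained problem if and only if $$\frac{n(n+2)}{2(n+1)} \le x < \frac{n+1}{2}.$$ -/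

import Mathlib

/-- A way of cutting each of `m` muffins into exactly two pieces, of positive size, and handing
the `2 * m` pieces to `s` students so that every student receives the same total `m / s`.
These are the feasible solutions of the supply-constrained muffin problem `(m, s)`. -/
structure MuffinSolution (m s : ℕ) where
  /-- `size i j` is the size of piece `j` of muffin `i`. -/
  size : Fin m → Fin 2 → ℝ
  /-- `student i j` is the student who receives piece `j` of muffin `i`. -/
  student : Fin m → Fin 2 → Fin s
  size_pos : ∀ i j, 0 < size i j
  sum_muffin : ∀ i, ∑ j, size i j = 1
  sum_student : ∀ k, (∑ i, ∑ j, if student i j = k then size i j else 0) = (m : ℝ) / (s : ℝ)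

namespace MuffinSolution

/-- The size of the smallest piece (a minimum over a finite set, nonempty when `0 < m`). -/
noncomputable def smallest {m s : ℕ} (D : MuffinSolution m s) : ℝ :=
  ⨅ p : Fin m × Fin 2, D.size p.1 p.2

/-- The number of pieces that student `k` receives. -/
def numPieces {m s : ℕ} (D : MuffinSolution m s) (k : Fin s) : ℕ :=
  (Finset.univ.filter fun p : Fin m × Fin 2 => D.student p.1 p.2 = k).card

/-- `D` is optimal for the supply-constrained muffin problem. -/
def SupplyOptimal {m s : ℕ} (D : MuffinSolution m s) : Prop :=
  ∀ E : MuffinSolution m s, E.smallest ≤ D.smallest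

/-- `D` is feasible for the fully-constrained muffin problem:
every student receives `n` or `n + 1` pieces, where `n = ⌊2 * m / s⌋`. -/
def FullyFeasible {m s : ℕ} (D : MuffinSolution m s) : Prop :=
  ∀ k, D.numPieces k = ⌊2 * ((m : ℝ) / (s : ℝ))⌋₊ ∨
    D.numPieces k = ⌊2 * ((m : ℝ) / (s : ℝ))⌋₊ + 1

/-- `D` is optimal for the fully-constrained muffin problem. -/
def FullyOptimal {m s : ℕ} (D : MuffinSolution m s) : Prop :=
  D.FullyFeasible ∧ ∀ E : MuffinSolution m s, E.FullyFeasible → E.smallest ≤ D.smallest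

end MuffinSolution

/-! Write 2m = ns + q and p = s - q, so that n and n+1 pieces per student means p students with n
pieces and q with n+1. Measure a piece by its deviation d from 1/2 in units of 1/(2s). Partner
pieces have opposite deviations, and a student with c pieces has total deviation q + (n - c)s: this
is q for c = n, -p for c = n+1. Conversely, any such family of multisets, symmetric under negation
and with |d| < s, is a solution (`exists_muffinSolution`).

Some student has at most n pieces, so some |d| is at least q/n. A student with at least n+2 pieces
forces a deviation at most -(2p+q)/(n+2); one with at most n-1 pieces forces one at least
(p+2q)/(n-1). The minimum of these two absolute values is `deviationBound`. The interval for x in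
the third claim amounts to np ≤ q, equivalently q/n ≥ (2p+q)/(n+2).

If np ≤ q, the bound q/n is attained by a fully feasible solution and also by one with an
(n+2)-piece student (`exists_family_with_large_member`). If q < np, there is a fully feasible
solution with all |d| strictly below `deviationBound` (`hasTwoGroupFamily_deviationBound`), which
beats every other kind of solution; compactness then supplies an optimum.

All but one of the constructions (for q = 0 all deviations are 0) fix most entries and leave at
least two free places for each incomplete student. These are filled by a cyclic flow through the
students, each receiving b and -a with b - a the missing sum; ordering the steps greedily keeps the
flow small (`exists_completion`). -/

/-! ### Cyclic flows with small values -/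

/-- A family of steps with sum `0` lying in `[-D, U]` can be traversed cyclically, starting at `g`
and ending at `0`, without leaving `[-D, U)`. -/
theorem exists_path_of_steps {κ : Type*} [DecidableEq κ] (t : κ → ℝ) {D U : ℝ}
    (hD : ∀ k, -D ≤ t k) (hU : ∀ k, t k ≤ U) :
    ∀ (A : Finset κ) (g : ℝ), -D ≤ g → g < U → g + ∑ k ∈ A, t k = 0 →
      ∃ a b : κ → ℝ, (∀ k ∈ A, b k - a k = t k) ∧
        (∀ k ∈ A, -D ≤ a k ∧ a k < U) ∧ (∀ k ∈ A, -D ≤ b k ∧ b k < U) ∧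
        (0 : ℝ) ::ₘ A.val.map a = g ::ₘ A.val.map b := by
  intro A
  induction A using Finset.strongInduction with
  | H A ih =>
    intro g hg1 hg2 hsum
    rcases A.eq_empty_or_nonempty with rfl | hA
    · refine ⟨t, t, by simp, by simp, by simp, ?_⟩
      have : g = 0 := by simpa using hsum
      simp [this]
    · obtain ⟨i, hi, h1, h2⟩ : ∃ i ∈ A, -D ≤ g + t i ∧ g + t i < U := by
        -- Greedy choice: step against the sign of the current position. Such a step exists because
        -- the remaining steps sum to -g.
        by_cases hg : 0 ≤ g
        · obtain ⟨i, hi, hti⟩ : ∃ i ∈ A, t i ≤ 0 := by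
            by_contra! h
            have := Finset.sum_pos h hA
            linarith
          exact ⟨i, hi, by linarith [hD i], by linarith⟩
        · obtain ⟨i, hi, hti⟩ : ∃ i ∈ A, 0 ≤ t i := by
            by_contra! h
            have := Finset.sum_neg h hA
            linarith
          exact ⟨i, hi, by linarith, by linarith [hU i]⟩
      have hs := Finset.add_sum_erase A t hi
      obtain ⟨a, b, hab, ha, hb, hm⟩ := ih (A.erase i) (Finset.erase_ssubset hi) (g + t i) h1 h2
        (by linarith)
      have hne : ∀ k ∈ A, k ≠ i → k ∈ A.erase i := fun k hk hki => Finset.mem_erase.2 ⟨hki, hk⟩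
      have hmap : ∀ (f : κ → ℝ) (x : ℝ),
          A.val.map (Function.update f i x) = x ::ₘ (A.erase i).val.map f := by
        intro f x
        rw [← Finset.insert_erase hi, Finset.insert_val_of_notMem (Finset.notMem_erase i A),
          Multiset.map_cons, Function.update_self, Finset.insert_erase hi]
        congr 1
        refine Multiset.map_congr rfl fun k hk => ?_
        have : k ≠ i := fun h => Finset.notMem_erase i A (h ▸ hk)
        simp [this]
      refine ⟨Function.update a i g, Function.update b i (g + t i), ?_, ?_, ?_, ?_⟩
      · intro k hk
        by_cases hki : k = i
        · subst hki; simp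
        · simpa [hki] using hab k (hne k hk hki)
      · intro k hk
        by_cases hki : k = i
        · subst hki; simp [hg1, hg2]
        · simpa [hki] using ha k (hne k hk hki)
      · intro k hk
        by_cases hki : k = i
        · subst hki; simp [h1, h2]
        · simpa [hki] using hb k (hne k hk hki)
      · rw [hmap, hmap, Multiset.cons_swap, hm]

/-- Steps with sum `0` are the differences of a cyclic flow whose values have absolute value
less than half the oscillation of the steps. -/
theorem exists_cyclic_flow {κ : Type*} [Fintype κ] (t : κ → ℝ) {D U C : ℝ}
    (hD : ∀ k, -D ≤ t k) (hU : ∀ k, t k ≤ U) (hD0 : 0 ≤ D) (hU0 : 0 < U) (hC : U + D ≤ 2 * C)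
    (ht : ∑ k, t k = 0) :
    ∃ a b : κ → ℝ, (∀ k, b k - a k = t k) ∧ (∀ k, |a k| < C) ∧ (∀ k, |b k| < C) ∧
      Finset.univ.val.map a = Finset.univ.val.map b := by
  classical
  obtain ⟨a, b, hab, ha, hb, hm⟩ := exists_path_of_steps t hD hU Finset.univ 0 (by linarith) hU0
    (by simpa using ht)
  rw [Multiset.cons_inj_right] at hm
  -- The attained maximum M is strictly below U. Centring [-D, M] at 0 therefore gives absolute
  -- values at most (D + M)/2 < C, strictly.
  obtain ⟨M, hM, haM⟩ : ∃ M < U, ∀ k, a k ≤ M := by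
    rcases isEmpty_or_nonempty κ with h | h
    · exact ⟨U - 1, by linarith, fun k => (h.false k).elim⟩
    · obtain ⟨k₀, hk₀⟩ := Finite.exists_max a
      exact ⟨a k₀, (ha k₀ (Finset.mem_univ _)).2, hk₀⟩
  have hbM : ∀ k, b k ≤ M := by
    intro k
    have : b k ∈ Finset.univ.val.map b := Multiset.mem_map_of_mem b (Finset.mem_univ_val k)
    rw [← hm] at this
    obtain ⟨k', -, hk'⟩ := Multiset.mem_map.1 this
    exact hk' ▸ haM k'
  refine ⟨fun k => a k + (D - M) / 2, fun k => b k + (D - M) / 2, ?_, ?_, ?_, ?_⟩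
  · intro k; have := hab k (Finset.mem_univ _); linarith
  · intro k
    have h1 := (ha k (Finset.mem_univ _)).1
    have h2 := haM k
    rw [abs_lt]; constructor <;> linarith
  · intro k
    have h1 := (hb k (Finset.mem_univ _)).1
    have h2 := hbM k
    rw [abs_lt]; constructor <;> linarith
  · have := congrArg (Multiset.map fun x => x + (D - M) / 2) hm
    simpa [Multiset.map_map, Function.comp_def] using this

/-! ### Symmetric families and their completion -/

/-- The values of a family of multisets of reals are, all together, symmetric under negation. -/
def NegSymmetric {ι : Type*} [Fintype ι] (F : ι → Multiset ℝ) : Prop :=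
  (∑ i, F i).map (fun x => -x) = ∑ i, F i

theorem Multiset.map_finsetSum {ι α β : Type*} (f : α → β) (A : Finset ι) (F : ι → Multiset α) :
    (∑ i ∈ A, F i).map f = ∑ i ∈ A, (F i).map f :=
  map_sum (Multiset.mapAddMonoidHom f) F A

theorem Multiset.sum_finsetSum {ι α : Type*} [AddCommMonoid α] (A : Finset ι)
    (F : ι → Multiset α) : (∑ i ∈ A, F i).sum = ∑ i ∈ A, (F i).sum :=
  map_sum (Multiset.sumAddMonoidHom (M := α)) F A

theorem Multiset.finsetSum_singleton {ι α : Type*} (A : Finset ι) (f : ι → α) :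
    ∑ i ∈ A, ({f i} : Multiset α) = A.val.map f := by
  classical
  induction A using Finset.induction_on with
  | empty => simp
  | insert i A hi ih => rw [Finset.sum_insert hi, ih, Finset.insert_val_of_notMem hi,
      Multiset.map_cons, Multiset.singleton_add]

theorem NegSymmetric.sum_eq_zero {ι : Type*} [Fintype ι] {F : ι → Multiset ℝ}
    (h : NegSymmetric F) : ∑ i, (F i).sum = 0 := by
  have := congrArg Multiset.sum h
  rw [Multiset.sum_map_neg', Multiset.sum_finsetSum] at this
  linarith

/-- Prescribed entries for a family of multisets can be completed to a family with prescribed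
cardinalities and sums: the multisets indexed by `ι` are already complete, and to each multiset
indexed by `κ` at least two entries have to be added. -/
theorem exists_completion {ι κ : Type*} [Fintype ι] [Fintype κ] (F : ι → Multiset ℝ)
    (G : κ → Multiset ℝ) (hsym : NegSymmetric (Sum.elim F G)) (deg : κ → ℕ) (need : κ → ℝ)
    (hdeg : ∀ k, (G k).card + 2 ≤ deg k) {D U C : ℝ}
    (hD : ∀ k, -D ≤ need k - (G k).sum) (hU : ∀ k, need k - (G k).sum ≤ U)
    (hD0 : 0 ≤ D) (hU0 : 0 < U) (hC : U + D ≤ 2 * C)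
    (hneed : ∑ i, (F i).sum + ∑ k, need k = 0) :
    ∃ H : κ → Multiset ℝ, NegSymmetric (Sum.elim F H) ∧ (∀ k, (H k).card = deg k) ∧
      (∀ k, (H k).sum = need k) ∧ ∀ k, ∀ d ∈ H k, d ∈ G k ∨ |d| < C := by
  have h0 := hsym.sum_eq_zero
  rw [Fintype.sum_sum_type] at h0
  simp only [Sum.elim_inl, Sum.elim_inr] at h0
  obtain ⟨a, b, hab, ha, hb, hm⟩ := exists_cyclic_flow (fun k => need k - (G k).sum) hD hU hD0
    hU0 hC (by rw [Finset.sum_sub_distrib]; linarith)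
  -- Negation exchanges the entries -a and b, since the a's and the b's agree as multisets; the
  -- padding zeros are their own opposites.
  refine ⟨fun k => G k + Multiset.replicate (deg k - 2 - (G k).card) 0 + {-a k} + {b k},
    ?_, ?_, ?_, ?_⟩
  · unfold NegSymmetric at hsym ⊢
    rw [Fintype.sum_sum_type] at hsym ⊢
    simp only [Sum.elim_inl, Sum.elim_inr, Finset.sum_add_distrib,
      Multiset.finsetSum_singleton, Multiset.map_add] at hsym ⊢
    have e1 : (Finset.univ.val.map fun k => -a k).map (fun x => -x) = Finset.univ.val.map b := by
      rw [Multiset.map_map, ← hm]; simp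
    have e2 : (Finset.univ.val.map b).map (fun x => -x) = Finset.univ.val.map fun k => -a k := by
      rw [← hm, Multiset.map_map]; rfl
    have e3 : (∑ k, Multiset.replicate (deg k - 2 - (G k).card) (0 : ℝ)).map (fun x => -x) =
        ∑ k, Multiset.replicate (deg k - 2 - (G k).card) (0 : ℝ) := by
      simp [Multiset.map_finsetSum]
    rw [e1, e2, e3]
    calc _ = ((∑ i, F i).map (fun x => -x) + (∑ k, G k).map (fun x => -x)) +
        ∑ k, Multiset.replicate (deg k - 2 - (G k).card) (0 : ℝ) +
        Finset.univ.val.map b + Finset.univ.val.map fun k => -a k := by abel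
      _ = _ := by rw [hsym]; abel
  · intro k; have := hdeg k; simp; omega
  · intro k; have := hab k; simp; linarith
  · intro k d hd
    have hC0 : 0 < C := by linarith
    simp only [Multiset.mem_add, Multiset.mem_singleton] at hd
    rcases hd with ((hd | hd) | hd) | hd
    · exact Or.inl hd
    · rw [Multiset.eq_of_mem_replicate hd]; simp [hC0]
    · rw [hd, abs_neg]; exact Or.inr (ha k)
    · rw [hd]; exact Or.inr (hb k)

/-! ### From deviations to muffin solutions -/

/-- A multiset can be distributed evenly. -/
theorem exists_distribution {α : Type*} (k l : ℕ) : ∀ (r : ℕ) (E : Multiset α),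
    k * r ≤ E.card → E.card ≤ l * r →
    ∃ G : Fin r → Multiset α, ∑ i, G i = E ∧ ∀ i, k ≤ (G i).card ∧ (G i).card ≤ l := by
  intro r
  induction r with
  | zero =>
    intro E _ h
    have : E = 0 := by simpa using h
    exact ⟨fun _ => 0, by simp [this], fun i => i.elim0⟩
  | succ r ih =>
    intro E h1 h2
    have hkl : k ≤ l := Nat.le_of_mul_le_mul_right (h1.trans h2) (Nat.succ_pos r)
    obtain ⟨c, hkc, hcl, hcE, h3, h4⟩ : ∃ c, k ≤ c ∧ c ≤ l ∧ c ≤ E.card ∧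
        k * r ≤ E.card - c ∧ E.card - c ≤ l * r := by
      have e1 : k * (r + 1) = k * r + k := by ring
      have e2 : l * (r + 1) = l * r + l := by ring
      have e3 : k * r ≤ l * r := Nat.mul_le_mul_right r hkl
      -- The first part is as small as allowed: at least k, and at least what the other r parts
      -- cannot absorb (truncated subtraction gives 0 if they can absorb everything).
      refine ⟨max k (E.card - l * r), ?_, ?_, ?_, ?_, ?_⟩ <;> omega
    obtain ⟨E', E'', rfl, hc⟩ : ∃ E' E'' : Multiset α, E = E' + E'' ∧ E'.card = c := by
      refine ⟨(E.toList.take c : List α), (E.toList.drop c : List α), ?_, ?_⟩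
      · rw [Multiset.coe_add, List.take_append_drop, Multiset.coe_toList]
      · simpa using hcE
    rw [Multiset.card_add] at h3 h4
    obtain ⟨G, hG, hG'⟩ := ih E'' (by omega) (by omega)
    refine ⟨Fin.cons E' G, by simp [Fin.sum_univ_succ, hG], fun i => ?_⟩
    refine Fin.cases ?_ (fun i => ?_) i
    · simp; omega
    · simpa using hG' i

/-- A multiset of labelled reals whose values are symmetric under negation splits into pairs with
opposite values. -/
theorem exists_pairing {ι : Type*} : ∀ (m : ℕ) (M : Multiset (ι × ℝ)), M.card = 2 * m →
    (M.map Prod.snd).map (fun x => -x) = M.map Prod.snd →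
    ∃ P : Fin m → Fin 2 → ι × ℝ, ∑ i, ∑ j, ({P i j} : Multiset (ι × ℝ)) = M ∧
      ∀ i, (P i 0).2 + (P i 1).2 = 0 := by
  intro m
  induction m with
  | zero =>
    intro M hM _
    have : M = 0 := by simpa using hM
    exact ⟨fun i => i.elim0, by simp [this], fun i => i.elim0⟩
  | succ m ih =>
    intro M hM hsym
    obtain ⟨u, v, N, rfl, huv⟩ : ∃ u v N, M = u ::ₘ v ::ₘ N ∧ u.2 + v.2 = 0 := by
      -- A nonzero value differs from its opposite, so symmetry provides a second element. If all
      -- values are 0, any two elements pair up.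
      by_cases h : ∃ u ∈ M, u.2 ≠ 0
      · obtain ⟨u, hu, hu0⟩ := h
        obtain ⟨N, rfl⟩ := Multiset.exists_cons_of_mem hu
        have : -u.2 ∈ (u ::ₘ N).map Prod.snd := by
          rw [← hsym]
          simp
        obtain ⟨v, hv, hvu⟩ := Multiset.mem_map.1 this
        rcases Multiset.mem_cons.1 hv with rfl | hv
        · exact absurd (by linarith) hu0
        · obtain ⟨N', rfl⟩ := Multiset.exists_cons_of_mem hv
          exact ⟨u, v, N', rfl, by rw [hvu]; ring⟩
      · push Not at h
        obtain ⟨u, hu⟩ := Multiset.card_pos_iff_exists_mem.1 (show 0 < M.card by omega)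
        obtain ⟨N, rfl⟩ := Multiset.exists_cons_of_mem hu
        rw [Multiset.card_cons] at hM
        obtain ⟨v, hv⟩ := Multiset.card_pos_iff_exists_mem.1 (show 0 < N.card by omega)
        obtain ⟨N', rfl⟩ := Multiset.exists_cons_of_mem hv
        exact ⟨u, v, N', rfl, by rw [h u (by simp), h v (by simp)]; ring⟩
    have hN : (N.map Prod.snd).map (fun x => -x) = N.map Prod.snd := by
      simp only [Multiset.map_cons] at hsym
      rw [show -u.2 = v.2 by linarith, show -v.2 = u.2 by linarith, Multiset.cons_swap] at hsym
      simpa using hsym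
    obtain ⟨P, hP, hP'⟩ := ih N (by simp at hM; omega) hN
    refine ⟨Fin.cons ![u, v] P, ?_, fun i => ?_⟩
    · rw [Fin.sum_univ_succ]
      simp only [Fin.cons_succ, hP]
      simp [Fin.sum_univ_two, Multiset.singleton_add]
    · refine Fin.cases ?_ (fun i => ?_) i
      · simpa using huv
      · simpa using hP' i

/-- A symmetric family of deviations from `1 / 2`, in units of `1 / (2 * s)`, is realized by a
solution of the supply-constrained muffin problem. -/
theorem exists_muffinSolution {m s : ℕ} (hs : 0 < s) {ι : Type*} [Fintype ι]
    (hι : Fintype.card ι = s) (F : ι → Multiset ℝ) (hF : NegSymmetric F)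
    (hsum : ∀ i, (F i).sum = 2 * m - s * (F i).card) (hlt : ∀ i, ∀ d ∈ F i, |d| < s) :
    ∃ (D : MuffinSolution m s) (e : Fin s ≃ ι), (∀ k, D.numPieces k = (F (e k)).card) ∧
      ∀ i j, ∃ k, ∃ d ∈ F k, D.size i j = 1 / 2 + d / (2 * s) := by
  classical
  have hs' : (0 : ℝ) < s := by exact_mod_cast hs
  let M : Multiset (ι × ℝ) := ∑ i, (F i).map fun d => (i, d)
  have hcard : M.card = 2 * m := by
    -- The total deviation vanishes, and this forces the number of entries to be 2m.
    have h := hF.sum_eq_zero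
    simp only [hsum, Finset.sum_sub_distrib, Finset.sum_const, Finset.card_univ, hι,
      ← Finset.mul_sum, nsmul_eq_mul] at h
    have h2 : (s : ℝ) * ((∑ i, ((F i).card : ℝ)) - 2 * m) = 0 := by linarith
    have h3 : (∑ i, ((F i).card : ℝ)) = 2 * m := by
      rcases mul_eq_zero.1 h2 with h2 | h2 <;> linarith
    have h4 : M.card = ∑ i, (F i).card := by
      simp [M]
    rw [h4]; exact_mod_cast h3
  have hsnd : M.map Prod.snd = ∑ i, F i := by
    simp [M, Multiset.map_finsetSum]
  obtain ⟨P, hP, hP0⟩ := exists_pairing m M hcard (by rw [hsnd]; exact hF)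
  have hsumP : ∀ {β : Type} [AddCommMonoid β] (f : ι × ℝ → β),
      ∑ i, ∑ j, f (P i j) = ∑ i, ((F i).map fun d => f (i, d)).sum := by
    intro β _ f
    have := congrArg (fun N : Multiset (ι × ℝ) => (N.map f).sum) hP
    simpa [M, Multiset.map_finsetSum, Multiset.sum_finsetSum, Multiset.map_map,
      Function.comp_def] using this
  have hmem : ∀ i j, ∃ k, ∃ d ∈ F k, P i j = (k, d) := by
    intro i j
    have : P i j ∈ M := by
      rw [← hP, Multiset.mem_sum]
      refine ⟨i, Finset.mem_univ _, ?_⟩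
      rw [Multiset.mem_sum]
      exact ⟨j, Finset.mem_univ _, by simp⟩
    obtain ⟨k, -, hk⟩ := Multiset.mem_sum.1 this
    obtain ⟨d, hd, h⟩ := Multiset.mem_map.1 hk
    exact ⟨k, d, hd, h.symm⟩
  have hfst : ∀ k, ∀ f : ι × ℝ → ℝ, (∑ i, ∑ j, if (P i j).1 = k then f (P i j) else 0) =
      ((F k).map fun d => f (k, d)).sum := by
    intro k f
    rw [hsumP fun u => if u.1 = k then f u else 0, Finset.sum_eq_single k]
    · simp
    · intro i _ hik; simp [hik]
    · simp
  let e : Fin s ≃ ι := (Fintype.equivFinOfCardEq hι).symm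
  refine ⟨⟨fun i j => 1 / 2 + (P i j).2 / (2 * s), fun i j => e.symm (P i j).1, ?_, ?_, ?_⟩, e,
    ?_, ?_⟩
  · intro i j
    obtain ⟨k, d, hd, h⟩ := hmem i j
    have := (abs_lt.1 (hlt k d hd)).1
    rw [h]
    have : -(1 / 2) < d / (2 * s) := by
      rw [lt_div_iff₀ (by positivity)]; linarith
    simp only
    linarith
  · intro i
    have := hP0 i
    rw [Fin.sum_univ_two]
    have : (P i 0).2 / (2 * s) + (P i 1).2 / (2 * s) = 0 := by
      rw [← add_div, this, zero_div]
    linarith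
  · intro k
    have h := hfst (e k) fun u => 1 / 2 + u.2 / (2 * s)
    simp only [Equiv.symm_apply_eq]
    have h2 : ((F (e k)).map fun d => 1 / 2 + d / (2 * (s : ℝ))).sum =
        (F (e k)).card * (1 / 2) + (F (e k)).sum / (2 * s) := by
      rw [Multiset.sum_map_add, Multiset.sum_map_div (f := fun d : ℝ => d), Multiset.map_const',
        Multiset.sum_replicate, nsmul_eq_mul, Multiset.map_id']
    rw [h, h2, hsum]
    field_simp
    ring
  · intro k
    have h := hfst (e k) fun _ => 1
    unfold MuffinSolution.numPieces
    rw [Finset.card_filter, Fintype.sum_prod_type]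
    simp only [Equiv.symm_apply_eq]
    have h2 : (∑ i, ∑ j, if (P i j).1 = e k then (1 : ℝ) else 0) = (F (e k)).card := by
      rw [h]; simp
    exact_mod_cast h2
  · intro i j
    obtain ⟨k, d, hd, h⟩ := hmem i j
    exact ⟨k, d, hd, by simp [h]⟩

/-! ### Families with two groups: givers and receivers -/

theorem Multiset.sum_mem_Icc {E : Multiset ℝ} {w v : ℝ} (h : ∀ x ∈ E, w ≤ x ∧ x ≤ v) :
    E.card * w ≤ E.sum ∧ E.sum ≤ E.card * v := by
  constructor
  · simpa using Multiset.card_nsmul_le_sum (s := E) (fun x hx => (h x hx).1)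
  · simpa using Multiset.sum_le_card_nsmul E v (fun x hx => (h x hx).2)

theorem NegSymmetric.neg {ι : Type*} [Fintype ι] {F : ι → Multiset ℝ} (h : NegSymmetric F) :
    NegSymmetric fun i => (F i).map (fun x => -x) := by
  unfold NegSymmetric at h ⊢
  rw [← Multiset.map_finsetSum, h, h]

/-- There is a symmetric family of multisets, `g` of which have cardinality `a` and sum `r`, and
`r` of which have cardinality `b` and sum `-g`, such that all elements satisfy `p`. -/
def HasTwoGroupFamily (g r a b : ℕ) (p : ℝ → Prop) : Prop :=
  ∃ (ι : Type) (_ : Fintype ι) (F : ι → Multiset ℝ), Fintype.card ι = g + r ∧ NegSymmetric F ∧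
    (∀ i, ((F i).card = a ∧ (F i).sum = r) ∨ ((F i).card = b ∧ (F i).sum = -g)) ∧
    ∀ i, ∀ d ∈ F i, p d

/-- `W` of the givers have `a - 2` entries `v`, the other givers have `a` entries `w`; each receiver
has between `k` and `l` of the opposite entries; the remaining entries form a cyclic flow. -/
theorem hasTwoGroupFamily_of_flow {g r a b W k l : ℕ} {v w D U C : ℝ} (hW : W ≤ g) (ha : 2 ≤ a)
    (hlb : l + 2 ≤ b) (hk : k * r + 2 * W ≤ a * g) (hl : a * g ≤ l * r + 2 * W)
    (hw : a * w = r) (hw0 : 0 ≤ w) (hwv : w ≤ v) (hD0 : 0 ≤ D) (hU0 : 0 < U)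
    (hC : U + D ≤ 2 * C) (hg : W = 0 ∨ (-D ≤ r - (a - 2) * v ∧ r - (a - 2) * v ≤ U))
    (hrD : g - k * w ≤ D) (hrU : l * v - g ≤ U) :
    HasTwoGroupFamily g r a b fun d => |d| ≤ v ∨ |d| < C := by
  have hv0 : 0 ≤ v := hw0.trans hwv
  obtain ⟨h, rfl⟩ := Nat.exists_eq_add_of_le hW
  obtain ⟨a, rfl⟩ := Nat.exists_eq_add_of_le ha
  let E : Multiset ℝ := h • Multiset.replicate (2 + a) w + W • Multiset.replicate a v
  have hE : ∀ x ∈ E, w ≤ x ∧ x ≤ v := by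
    intro x hx
    rcases Multiset.mem_add.1 hx with hx | hx
    · rw [Multiset.eq_of_mem_replicate (Multiset.mem_of_mem_nsmul hx)]; exact ⟨le_rfl, hwv⟩
    · rw [Multiset.eq_of_mem_replicate (Multiset.mem_of_mem_nsmul hx)]; exact ⟨hwv, le_rfl⟩
  have hEc : E.card + 2 * W = (2 + a) * (W + h) := by simp [E]; ring
  obtain ⟨G, hGE, hG⟩ := exists_distribution k l r E (by omega) (by omega)
  have hGmem : ∀ i, ∀ x ∈ G i, w ≤ x ∧ x ≤ v := by
    intro i x hx
    exact hE x (hGE ▸ Multiset.mem_sum.2 ⟨i, Finset.mem_univ _, hx⟩)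
  push_cast at hw hg hrD hrU
  have key := exists_completion (ι := Fin h) (κ := Fin W ⊕ Fin r)
    (fun _ => Multiset.replicate (2 + a) w)
    (Sum.elim (fun _ => Multiset.replicate a v) fun i => (G i).map fun x => -x) ?_
    (Sum.elim (fun _ => 2 + a) fun _ => b)
    (Sum.elim (fun _ => (r : ℝ)) fun _ => -((W + h : ℕ) : ℝ)) ?_ (D := D) (U := U) (C := C) ?_ ?_
    hD0 hU0 hC ?_
  · obtain ⟨H, hsym, hcard, hsum, hmem⟩ := key
    refine ⟨Fin h ⊕ (Fin W ⊕ Fin r), inferInstance,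
      Sum.elim (fun _ => Multiset.replicate (2 + a) w) H, ?_, hsym, ?_, ?_⟩
    · simp; ring
    · rintro (i | i | i)
      · left; simp [hw]
      · left; exact ⟨by simp [hcard], by simp [hsum]⟩
      · right; exact ⟨by simp [hcard], by simp [hsum]⟩
    · rintro (i | i) d hd
      · left
        rw [Multiset.eq_of_mem_replicate hd, abs_of_nonneg hw0]; exact hwv
      · rcases hmem i d hd with hd | hd
        · left
          rcases i with i | i
          · rw [Multiset.eq_of_mem_replicate hd, abs_of_nonneg hv0]
          · obtain ⟨x, hx, rfl⟩ := Multiset.mem_map.1 hd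
            have := hGmem i x hx
            rw [abs_neg, abs_of_nonneg (by linarith)]; exact this.2
        · exact Or.inr hd
  · have e : ∑ i, (G i).map (fun x => -x) = E.map (fun x => -x) := by
      rw [← Multiset.map_finsetSum, hGE]
    unfold NegSymmetric
    simp only [Fintype.sum_sum_type, Sum.elim_inl, Sum.elim_inr, e, Finset.sum_const,
      Finset.card_univ, Fintype.card_fin]
    rw [← add_assoc]
    change (E + _).map _ = E + _
    rw [Multiset.map_add, Multiset.map_map]
    simp [add_comm]
  · rintro (i | i)
    · simp; omega
    · have := hG i; simp; omega
  · rintro (i | i)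
    · rcases hg with rfl | hg
      · exact i.elim0
      · simp; linarith [hg.1]
    · have h1 := (Multiset.sum_mem_Icc (hGmem i)).1
      have h2 : (k : ℝ) * w ≤ (G i).card * w :=
        mul_le_mul_of_nonneg_right (by exact_mod_cast (hG i).1) hw0
      simp [Multiset.sum_map_neg']; linarith
  · rintro (i | i)
    · rcases hg with rfl | hg
      · exact i.elim0
      · simp; linarith [hg.2]
    · have h1 := (Multiset.sum_mem_Icc (hGmem i)).2
      have h2 : ((G i).card : ℝ) * v ≤ l * v :=
        mul_le_mul_of_nonneg_right (by exact_mod_cast (hG i).2) hv0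
      simp [Multiset.sum_map_neg']; linarith
  · simp [Fintype.sum_sum_type, hw]; ring

/-- If the receivers are numerous enough, all givers may have constant entries. -/
theorem hasTwoGroupFamily_of_le {g r a b : ℕ} (hg : 0 < g) (hr : 0 < r) (ha : 2 ≤ a)
    (h : a * g + 2 * r ≤ b * r) : HasTwoGroupFamily g r a b fun d => |d| ≤ (r : ℝ) / a := by
  have ha' : (0 : ℝ) < a := by positivity
  have hr' : (0 : ℝ) < r := by positivity
  -- Here k + 1 is the ceiling of ag/r, so each receiver takes k or k + 1 opposites of r/a and its
  -- missing sum lies in [-r/a, r/a].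
  obtain ⟨k, hk1, hk2⟩ : ∃ k, k * r < a * g ∧ a * g ≤ (k + 1) * r := by
    refine ⟨(a * g - 1) / r, ?_, ?_⟩
    · have := Nat.div_mul_le_self (a * g - 1) r
      have : 0 < a * g := by positivity
      omega
    · have := Nat.lt_mul_div_succ (a * g - 1) hr
      rw [mul_comm r] at this
      omega
  have hkb : k + 1 + 2 ≤ b := by
    by_contra! hb
    have : b * r ≤ (k + 2) * r := Nat.mul_le_mul_right r (by omega)
    have : (k + 2) * r = k * r + 2 * r := by ring
    omega
  have hw : (a : ℝ) * (r / a) = r := by field_simp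
  have h1 : (k : ℝ) * r ≤ a * g := by exact_mod_cast hk1.le
  have h2 : (a : ℝ) * g ≤ (k + 1) * r := by exact_mod_cast hk2
  have hg1 : (k : ℝ) * (r / a) ≤ g := by
    rw [← mul_div_assoc, div_le_iff₀ ha']; linarith
  have hg2 : (g : ℝ) ≤ (k + 1) * (r / a) := by
    rw [← mul_div_assoc, le_div_iff₀ ha']; linarith
  obtain ⟨ι, _, F, hc, hsym, hF, hF'⟩ := hasTwoGroupFamily_of_flow (g := g) (r := r) (a := a)
    (b := b) (W := 0) (k := k) (l := k + 1) (v := r / a) (w := r / a) (D := r / a) (U := r / a)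
    (C := r / a) (Nat.zero_le _) ha hkb (by omega) (by omega) hw (by positivity) le_rfl
    (by positivity) (by positivity) (by linarith) (Or.inl rfl) (by linarith)
    (by push_cast; linarith)
  exact ⟨ι, _, F, hc, hsym, hF, fun i d hd => (hF' i d hd).elim id le_of_lt⟩

/-- If the receivers are less numerous, some of the givers have to take part in the flow. -/
theorem hasTwoGroupFamily_of_ge {g r a c : ℕ} {C : ℝ} (hr : 0 < r) (ha : 2 ≤ a)
    (h1 : (c + 1) * r ≤ a * g) (h2 : a * g ≤ (c + 1) * r + 2 * g) (hC1 : (r : ℝ) / a < C)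
    (hC2 : (a : ℝ) * g + (a - c) * r < a ^ 2 * C)
    (hC3 : (c + 1 : ℝ) * (a * g + (a - c) * r) - a * c * r ≤ a ^ 2 * (2 * C)) :
    HasTwoGroupFamily g r a (c + 3) fun d => |d| < C := by
  have ha' : (0 : ℝ) < a := by positivity
  have hr' : (0 : ℝ) < r := by positivity
  obtain ⟨w, hw⟩ : ∃ w : ℝ, w = r / a := ⟨_, rfl⟩
  -- u is the least v for which the need r - (a-2)v of a giver in the flow exceeds the lowest
  -- receiver need -(g - cw) by at most 2v.
  obtain ⟨u, hu⟩ : ∃ u : ℝ, u = (g + r - c * w) / a := ⟨_, rfl⟩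
  have hwa : (a : ℝ) * w = r := by rw [hw]; field_simp
  have hua : (a : ℝ) * u = g + r - c * w := by rw [hu]; field_simp
  have hw0 : 0 < w := by rw [hw]; positivity
  rw [← hw] at hC1
  have huC : u < C := by
    have : (a : ℝ) ^ 2 * u < a ^ 2 * C := by
      have : (a : ℝ) ^ 2 * u = a * g + (a - c) * r := by
        rw [pow_two, mul_assoc, hua]; linear_combination -(c : ℝ) * hwa
      linarith
    exact lt_of_mul_lt_mul_left this (by positivity)
  have huC2 : (c + 1 : ℝ) * u - c * w ≤ 2 * C := by
    have : (a : ℝ) ^ 2 * ((c + 1 : ℝ) * u - c * w) ≤ a ^ 2 * (2 * C) := by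
      have : (a : ℝ) ^ 2 * ((c + 1 : ℝ) * u - c * w) =
          (c + 1 : ℝ) * (a * g + (a - c) * r) - a * c * r := by
        linear_combination (c + 1 : ℝ) * a * hua - (c * (c + 1) + c * a : ℝ) * hwa
      linarith
    exact le_of_mul_le_mul_left this (by positivity)
  obtain ⟨v, hv⟩ : ∃ v : ℝ, v = max w u := ⟨_, rfl⟩
  have hwv : w ≤ v := hv ▸ le_max_left _ _
  have huv : u ≤ v := hv ▸ le_max_right _ _
  have hvC : v < C := hv ▸ max_lt hC1 huC
  have hlast : (c + 1 : ℝ) * v - c * w ≤ 2 * C := by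
    rcases max_choice w u with h | h
    · rw [hv, h]; linarith
    · rw [hv, h]; exact huC2
  have ha2 : (2 : ℝ) ≤ a := by exact_mod_cast ha
  have hgD : c * w ≤ g := by
    have : (c : ℝ) * r ≤ a * g := by
      have : ((c : ℝ) + 1) * r ≤ a * g := by exact_mod_cast h1
      linarith
    rw [hw, ← mul_div_assoc, div_le_iff₀ ha']; linarith
  have hgv : (a - 2 : ℝ) * v + c * w ≤ r + g := by
    rcases max_choice w u with h | h
    · rw [hv, h]; linarith
    · rw [hv, h]; have : w ≤ u := h ▸ le_max_left _ _
      linarith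
  have hgv' : r + g ≤ (a - 2 : ℝ) * v + c * w + 2 * v := by
    have := mul_le_mul_of_nonneg_left huv ha'.le
    linarith
  -- The least number of givers in the flow for which the ag - 2W opposites fit into c + 1 places
  -- per receiver; rounding up costs at most one, so c per receiver are still filled.
  obtain ⟨W, hW1, hW2⟩ : ∃ W, a * g ≤ (c + 1) * r + 2 * W ∧
      2 * W ≤ a * g - (c + 1) * r + 1 := ⟨(a * g - (c + 1) * r + 1) / 2, by omega, by omega⟩
  have e : (c + 1) * r = c * r + r := by ring
  have key := hasTwoGroupFamily_of_flow (g := g) (r := r) (a := a)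
    (b := c + 3) (W := W) (k := c) (l := c + 1) (v := v) (w := w) (D := g - c * w)
    (U := 2 * C - (g - c * w)) (C := C) (by omega) ha le_rfl (by omega) (by omega) hwa hw0.le hwv
    (by linarith) ?_ (by linarith) (Or.inr ⟨by linarith, by linarith⟩) le_rfl
    (by push_cast; linarith)
  · obtain ⟨ι, _, F, hc, hsym, hF, hF'⟩ := key
    exact ⟨ι, _, F, hc, hsym, hF, fun i d hd => (hF' i d hd).elim (fun h => h.trans_lt hvC) id⟩
  -- Positivity of U. If g ≥ (c+1)v, the bound (a-2)g ≤ (c+1)r yields (a-2)v ≤ r, hence g - cw ≤ 2v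
  -- < 2C.
  · rcases lt_or_ge (g : ℝ) ((c + 1 : ℝ) * v) with h | h
    · linarith
    · have h3 : ((a : ℝ) - 2) * g ≤ (c + 1) * r := by
        have : (a : ℝ) * g ≤ (c + 1) * r + 2 * g := by exact_mod_cast h2
        linarith
      have h4 : (c + 1 : ℝ) * ((a - 2) * v) ≤ (c + 1) * r := by
        have := mul_le_mul_of_nonneg_left h (sub_nonneg.2 ha2)
        linarith
      have := le_of_mul_le_mul_left h4 (by positivity)
      linarith

theorem HasTwoGroupFamily.mono {g r a b : ℕ} {p p' : ℝ → Prop} (h : HasTwoGroupFamily g r a b p)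
    (hp : ∀ d, p d → p' d) : HasTwoGroupFamily g r a b p' := by
  obtain ⟨ι, _, F, hc, hsym, hF, hF'⟩ := h
  exact ⟨ι, _, F, hc, hsym, hF, fun i d hd => hp d (hF' i d hd)⟩

/-- Negating all deviations interchanges givers and receivers, so either group may play the role of
the givers. -/
theorem HasTwoGroupFamily.swap {g r a b : ℕ} {C : ℝ}
    (h : HasTwoGroupFamily g r a b fun d => |d| < C) :
    HasTwoGroupFamily r g b a fun d => |d| < C := by
  obtain ⟨ι, _, F, hc, hsym, hF, hF'⟩ := h
  refine ⟨ι, _, fun i => (F i).map fun x => -x, by rw [hc, add_comm], hsym.neg, fun i => ?_,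
    fun i d hd => ?_⟩
  · rcases hF i with h | h
    · right; simp [Multiset.sum_map_neg', h.1, h.2]
    · left; simp [Multiset.sum_map_neg', h.1, h.2]
  · obtain ⟨x, hx, rfl⟩ := Multiset.mem_map.1 hd
    rw [abs_neg]; exact hF' i x hx

/-! ### Below the threshold: deviations under the bound -/

theorem lt_mul_min {x y a b : ℝ} (ha : x < y * a) (hb : x < y * b) : x < y * min a b := by
  rcases min_choice a b with h | h <;> rwa [h]

theorem le_mul_two_mul_min {x y a b : ℝ} (ha : x ≤ y * (2 * a)) (hb : x ≤ y * (2 * b)) :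
    x ≤ y * (2 * min a b) := by
  rcases min_choice a b with h | h <;> rwa [h]

/-- The strict upper bound for the deviations (in units of `1 / (2 * s)`) that excludes students
with `n + 2` or more pieces, and students with `n - 1` or fewer pieces. -/
noncomputable def deviationBound (p q n : ℕ) : ℝ :=
  min ((2 * p + q) / (n + 2)) ((p + 2 * q) / (n - 1))

/-- Evenness makes p - q/2 an integer. With that many givers left wholly to the flow, the others
contribute q entries q/2, and each receiver takes exactly one opposite. The flow bound (2p+q)/4
equals the bound coming from n+2 pieces, so its strictness is essential. -/
theorem hasTwoGroupFamily_two {p q : ℕ} (hq0 : 0 < q) (hq : Even q) (hqp : q < 2 * p) :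
    HasTwoGroupFamily p q 2 3 fun d => |d| < deviationBound p q 2 := by
  obtain ⟨h, rfl⟩ := hq
  have hqp' : (h : ℝ) < p := by exact_mod_cast (show h < p by omega)
  have hh : (0 : ℝ) < h := by exact_mod_cast (show 0 < h by omega)
  have hb : (2 * (p : ℝ) + 2 * h) / 4 ≤ deviationBound p (h + h) 2 := by
    unfold deviationBound
    push_cast
    refine le_min (by apply le_of_eq; ring) ?_
    norm_num
    linarith
  refine (hasTwoGroupFamily_of_flow (W := p - h) (k := 1) (l := 1) (v := h) (w := h) (D := p - h)
    (U := 2 * h) (C := (2 * p + 2 * h) / 4) (by omega) le_rfl le_rfl (by omega) (by omega)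
    (by push_cast; ring) hh.le le_rfl (by linarith) (by linarith) (by linarith)
    (Or.inr ⟨?_, ?_⟩) ?_ ?_).mono fun d hd => ?_
  · push_cast; linarith
  · push_cast; linarith
  · push_cast; linarith
  · push_cast; linarith
  · rcases hd with hd | hd
    · refine hd.trans_lt (lt_of_lt_of_le ?_ hb); linarith
    · exact hd.trans_le hb

/-- With two places per student kept for the flow, the two groups have (n-2)p and (n-1)q other
places, where n = k + 3. The group with fewer such places can act as the givers; here it is the
students with n pieces. -/
theorem hasTwoGroupFamily_of_givers_left {p q k : ℕ} (hp : 0 < p) (hq : 0 < q)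
    (hqp : q < (k + 3) * p) (h : (k + 1) * p ≤ (k + 2) * q) :
    HasTwoGroupFamily p q (k + 3) (k + 4) fun d => |d| < deviationBound p q (k + 3) := by
  have hp' : (0 : ℝ) < p := by exact_mod_cast hp
  have hq' : (0 : ℝ) < q := by exact_mod_cast hq
  have hk : (0 : ℝ) ≤ k := Nat.cast_nonneg k
  have hqp' : (q : ℝ) < (k + 3) * p := by exact_mod_cast hqp
  have h' : (k + 1 : ℝ) * p ≤ (k + 2) * q := by exact_mod_cast h
  have hw : (q : ℝ) / (k + 3 : ℕ) < deviationBound p q (k + 3) := by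
    unfold deviationBound
    push_cast
    -- The first inequality, q/n < (2p+q)/(n+2), is equivalent to q < np.
    refine lt_min ?_ ?_
    · rw [div_lt_div_iff₀ (by positivity) (by positivity)]; nlinarith
    · rw [div_lt_div_iff₀ (by positivity) (by linarith)]; nlinarith
  rcases le_total ((k + 3) * p + 2 * q) ((k + 4) * q) with h1 | h1
  · exact (hasTwoGroupFamily_of_le hp hq (by omega) h1).mono fun d hd => hd.trans_lt hw
  · refine hasTwoGroupFamily_of_ge (c := k + 1) hq (by omega) (by linarith) (by linarith) hw ?_ ?_
    · unfold deviationBound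
      push_cast
      apply lt_mul_min
      · rw [← mul_div_assoc, lt_div_iff₀ (by positivity)]
        nlinarith [mul_nonneg hk hp'.le, mul_nonneg hk hq'.le, mul_nonneg (mul_nonneg hk hk) hq'.le,
          mul_nonneg (mul_nonneg hk hk) hp'.le]
      · rw [← mul_div_assoc, lt_div_iff₀ (by linarith)]
        nlinarith [mul_nonneg hk hp'.le, mul_nonneg hk hq'.le, mul_nonneg (mul_nonneg hk hk) hq'.le,
          mul_nonneg (mul_nonneg hk hk) hp'.le]
    · unfold deviationBound
      push_cast
      -- The general certificates use the factors k² + 3k - 2 and k² + 2k - 2, which are negative at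
      -- k = 0.
      rcases Nat.eq_zero_or_pos k with rfl | hk1
      · simp only [Nat.cast_zero] at h' ⊢
        apply le_mul_two_mul_min <;> linarith
      have hk1 : (1 : ℝ) ≤ k := by exact_mod_cast hk1
      apply le_mul_two_mul_min
      · rw [← mul_div_assoc, ← mul_div_assoc, le_div_iff₀ (by positivity)]
        have e1 := mul_nonneg (mul_nonneg (by linarith : (0 : ℝ) ≤ k + 3)
          (by nlinarith : (0 : ℝ) ≤ k ^ 2 + 3 * k - 2)) (sub_nonneg.2 h')
        have e2 : (0 : ℝ) ≤ (2 * k ^ 3 + 11 * k ^ 2 + 26 * k + 25) * q := by positivity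
        refine le_of_mul_le_mul_left ?_ (by linarith : (0 : ℝ) < k + 1)
        linarith
      · rw [← mul_div_assoc, ← mul_div_assoc, le_div_iff₀ (by linarith)]
        have e1 := mul_nonneg (mul_nonneg (by linarith : (0 : ℝ) ≤ k + 3)
          (by nlinarith : (0 : ℝ) ≤ k ^ 2 + 2 * k - 2)) (sub_nonneg.2 h')
        have e2 : (0 : ℝ) ≤ (2 * k ^ 3 + 21 * k ^ 2 + 59 * k + 46) * q := by positivity
        refine le_of_mul_le_mul_left ?_ (by linarith : (0 : ℝ) < k + 1)
        linarith

/-- The complementary case: the students with n + 1 pieces have fewer places outside the flow and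
become the givers after negation. -/
theorem hasTwoGroupFamily_of_givers_right {p q k : ℕ} (hp : 0 < p) (hq : 0 < q)
    (h : (k + 2) * q ≤ (k + 1) * p) :
    HasTwoGroupFamily p q (k + 3) (k + 4) fun d => |d| < deviationBound p q (k + 3) := by
  have hp' : (0 : ℝ) < p := by exact_mod_cast hp
  have hq' : (0 : ℝ) < q := by exact_mod_cast hq
  have hk : (0 : ℝ) ≤ k := Nat.cast_nonneg k
  have h' : (k + 2 : ℝ) * q ≤ (k + 1) * p := by exact_mod_cast h
  have hqp : (q : ℝ) ≤ p := by nlinarith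
  have hw : (p : ℝ) / (k + 4 : ℕ) < deviationBound p q (k + 3) := by
    unfold deviationBound
    push_cast
    refine lt_min ?_ ?_
    · rw [div_lt_div_iff₀ (by positivity) (by positivity)]; nlinarith
    · rw [div_lt_div_iff₀ (by positivity) (by linarith)]; nlinarith
  apply HasTwoGroupFamily.swap
  rcases le_total ((k + 4) * q + 2 * p) ((k + 3) * p) with h1 | h1
  · exact (hasTwoGroupFamily_of_le hq hp (by omega) h1).mono fun d hd => hd.trans_lt hw
  · refine hasTwoGroupFamily_of_ge (c := k) hp (by omega) (by linarith) (by linarith) hw ?_ ?_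
    · unfold deviationBound
      push_cast
      apply lt_mul_min
      · rw [← mul_div_assoc, lt_div_iff₀ (by positivity)]
        nlinarith [mul_nonneg hk hp'.le, mul_nonneg hk hq'.le, mul_nonneg (mul_nonneg hk hk) hq'.le,
          mul_nonneg (mul_nonneg hk hk) hp'.le]
      · rw [← mul_div_assoc, lt_div_iff₀ (by linarith)]
        nlinarith [mul_nonneg hk hp'.le, mul_nonneg hk hq'.le, mul_nonneg (mul_nonneg hk hk) hq'.le,
          mul_nonneg (mul_nonneg hk hk) hp'.le]
    · unfold deviationBound
      push_cast
      apply le_mul_two_mul_min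
      · rw [← mul_div_assoc, ← mul_div_assoc, le_div_iff₀ (by positivity)]
        have e1 := mul_nonneg (by positivity : (0 : ℝ) ≤ k ^ 3 + 8 * k ^ 2 + 13 * k) (sub_nonneg.2 hqp)
        have e2 : (0 : ℝ) ≤ (k ^ 2 + 15 * k + 44) * p + (12) * q := by positivity
        linarith
      · rw [← mul_div_assoc, ← mul_div_assoc, le_div_iff₀ (by linarith)]
        have e1 := mul_nonneg (by positivity : (0 : ℝ) ≤ k ^ 3 + 3 * k ^ 2) (sub_nonneg.2 hqp)
        have e2 : (0 : ℝ) ≤ (k ^ 2 + 12 * k + 24) * p + (18 * k + 56) * q := by positivity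
        linarith

theorem hasTwoGroupFamily_deviationBound {p q n : ℕ} (hn : 2 ≤ n) (hp : 0 < p) (hq : 0 < q)
    (hqp : q < n * p) (h2 : n = 2 → Even q) :
    HasTwoGroupFamily p q n (n + 1) fun d => |d| < deviationBound p q n := by
  rcases hn.eq_or_lt with rfl | hn
  · exact hasTwoGroupFamily_two hq (h2 rfl) hqp
  · obtain ⟨k, rfl⟩ := Nat.exists_eq_add_of_le' hn
    rcases le_total ((k + 1) * p) ((k + 2) * q) with h | h
    · exact hasTwoGroupFamily_of_givers_left hp hq hqp h
    · exact hasTwoGroupFamily_of_givers_right hp hq h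

/-- The case q = 0, where every muffin can be halved. -/
theorem hasTwoGroupFamily_zero {p n b : ℕ} {C : ℝ} (hC : 0 < C) :
    HasTwoGroupFamily p 0 n b fun d => |d| < C := by
  refine ⟨Fin p, inferInstance, fun _ => Multiset.replicate n 0, by simp, ?_, by simp, ?_⟩
  · simp [NegSymmetric, Multiset.map_nsmul]
  · intro i d hd
    rw [Multiset.eq_of_mem_replicate hd]; simpa using hC

theorem multiset_sum_eq_of_forall_mem {ι : Type*} {p q n : ℕ} {F : ι → Multiset ℝ}
    (hF : ∀ i, ((F i).card = n ∧ (F i).sum = q) ∨ ((F i).card = n + 1 ∧ (F i).sum = -p)) (i : ι) :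
    (F i).sum = q + (n - (F i).card) * (p + q) := by
  rcases hF i with ⟨h1, h2⟩ | ⟨h1, h2⟩
  · rw [h1, h2]; ring
  · rw [h1, h2]; push_cast; ring

/-! ### Above the threshold: a student with n + 2 pieces -/

theorem negSymmetric_of_sum_eq {ι : Type*} [Fintype ι] {F : ι → Multiset ℝ} {N : ℕ} {w : ℝ}
    {S : Multiset ℝ} (hS : S.map (fun x => -x) = S)
    (h : ∑ i, F i = Multiset.replicate N w + Multiset.replicate N (-w) + S) : NegSymmetric F := by
  unfold NegSymmetric
  rw [h]
  simp [hS, add_comm]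

/-- A family in which some student receives `n + 2` pieces, all other students `n` or `n + 1`. -/
theorem exists_family_with_large_member {p q n : ℕ} (hn : 2 ≤ n) (hp : 0 < p) (hqp : n * p ≤ q)
    (h2 : n = 2 → Even q) :
    ∃ (ι : Type) (_ : Fintype ι) (F : ι → Multiset ℝ), Fintype.card ι = p + q ∧ NegSymmetric F ∧
      (∀ i, (F i).sum = q + (n - (F i).card) * (p + q)) ∧
      (∀ i, ∀ d ∈ F i, |d| ≤ (q : ℝ) / n) ∧ ∃ i, (F i).card = n + 2 := by
  have hn' : (0 : ℝ) < n := by positivity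
  obtain ⟨w, hw⟩ : ∃ w : ℝ, w = q / n := ⟨_, rfl⟩
  have hwn : (n : ℝ) * w = q := by rw [hw]; field_simp
  have hpw : (p : ℝ) ≤ w := by
    rw [hw, le_div_iff₀ hn']; rw [mul_comm]; exact_mod_cast hqp
  have hp' : (0 : ℝ) < p := by exact_mod_cast hp
  have hw0 : 0 < w := hp'.trans_le hpw
  rw [← hw]
  have hnp : n ≤ n * p := Nat.le_mul_of_pos_right n hp
  -- An (n+2)-piece student is balanced by an extra n-piece student: p + 1 students have n entries
  -- w, and q - 2 have n + 1 entries. The cases differ in where the n(p+1) entries -w go; the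
  -- generic one, q ≥ np + 2, gives n of them to the large student and one each to np others.
  rcases (by omega : n * p = q ∨ n * p + 1 = q ∨ n * p + 2 ≤ q) with h | h | h
  · obtain ⟨r, hr⟩ := Nat.exists_eq_add_of_le (hn.trans (hnp.trans hqp))
    have hrq : (q : ℝ) = 2 + r := by exact_mod_cast hr
    have hq : (n : ℝ) * p = q := by exact_mod_cast h
    have hwp : w = p := mul_left_cancel₀ hn'.ne' (hwn.trans hq.symm)
    -- Here w = p, so the large student's sum -(q + 2p) is exactly n + 2 entries -w, and one -w
    -- remains for each of the other q - 2 students.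
    have key := exists_completion (ι := Fin (p + 1) ⊕ Unit) (κ := Fin r)
      (Sum.elim (fun _ => Multiset.replicate n w) fun _ => Multiset.replicate (n + 2) (-w))
      (fun _ => {-w}) ?_ (fun _ => n + 1) (fun _ => -(p : ℝ)) ?_ (D := 0) (U := w) (C := w)
      ?_ ?_ le_rfl hw0 (by linarith) ?_
    · obtain ⟨H, hsym, hcard, hsum, hmem⟩ := key
      refine ⟨_, inferInstance, _, ?_, hsym, ?_, ?_, Sum.inl (Sum.inr ()), by simp⟩
      · simp; omega
      · rintro ((i | i) | i)
        · simp [hwn]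
        · simp; rw [hwp]; linarith
        · simp [hcard, hsum]
      · rintro ((i | i) | i) d hd
        · rw [Multiset.eq_of_mem_replicate hd, abs_of_pos hw0]
        · rw [Multiset.eq_of_mem_replicate hd, abs_neg, abs_of_pos hw0]
        · rcases hmem i d hd with hd | hd
          · rw [Multiset.mem_singleton.1 hd, abs_neg, abs_of_pos hw0]
          · exact hd.le
    · refine negSymmetric_of_sum_eq (N := n * (p + 1)) (w := w) (S := 0) rfl ?_
      simp only [Fintype.sum_sum_type, Sum.elim_inl, Sum.elim_inr, Finset.sum_const,
        Finset.card_univ, Fintype.card_fin, Fintype.card_unit, one_smul,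
        ← Multiset.replicate_one, Multiset.nsmul_replicate, add_zero]
      rw [add_assoc, ← Multiset.replicate_add]
      congr 2 <;> linarith
    · intro i; simp; omega
    · intro i; simp; linarith
    · intro i; simp
    · simp [Fintype.sum_sum_type, hwn]; rw [hwp]; linear_combination (p : ℝ) * hrq
  · have hn3 : 3 ≤ n := by
      rcases hn.eq_or_lt with rfl | hn
      · have := h2 rfl; rw [← h] at this; simp at this
      · exact hn
    obtain ⟨r, hr⟩ := Nat.exists_eq_add_of_le (show 3 ≤ q by omega)
    have hrq : (q : ℝ) = 3 + r := by exact_mod_cast hr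
    have hq : (n : ℝ) * p + 1 = q := by exact_mod_cast h
    have hwp : (p : ℝ) < w := by
      refine lt_of_mul_lt_mul_left ?_ hn'.le
      linarith
    have hS : |w - 2 * p| ≤ w := by rw [abs_le]; constructor <;> linarith
    -- The entry w - 2p corrects the large student's sum to -(q + 2p); its opposite goes to one
    -- distinguished student with n + 1 pieces.
    have key := exists_completion (ι := Fin (p + 1) ⊕ Unit) (κ := Unit ⊕ Fin r)
      (Sum.elim (fun _ => Multiset.replicate n w)
        fun _ => Multiset.replicate (n + 1) (-w) + {w - 2 * p})
      (Sum.elim (fun _ => {-w} + {-(w - 2 * p)}) fun _ => {-w}) ?_ (fun _ => n + 1)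
      (fun _ => -(p : ℝ)) ?_ (D := p) (U := 2 * (w - p)) (C := w) ?_ ?_ hp'.le (by linarith)
      (by linarith) ?_
    · obtain ⟨H, hsym, hcard, hsum, hmem⟩ := key
      refine ⟨_, inferInstance, _, ?_, hsym, ?_, ?_, Sum.inl (Sum.inr ()), by simp⟩
      · simp; omega
      · rintro ((i | i) | i)
        · simp [hwn]
        · simp; linarith
        · simp [hcard, hsum]
      · rintro ((i | i) | i) d hd
        · rw [Multiset.eq_of_mem_replicate hd, abs_of_pos hw0]
        · rcases Multiset.mem_add.1 hd with hd | hd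
          · rw [Multiset.eq_of_mem_replicate hd, abs_neg, abs_of_pos hw0]
          · rw [Multiset.mem_singleton.1 hd]; exact hS
        · rcases hmem i d hd with hd | hd
          · rcases i with i | i
            · rcases Multiset.mem_add.1 hd with hd | hd
              · rw [Multiset.mem_singleton.1 hd, abs_neg, abs_of_pos hw0]
              · rw [Multiset.mem_singleton.1 hd, abs_neg]; exact hS
            · rw [Multiset.mem_singleton.1 hd, abs_neg, abs_of_pos hw0]
          · exact hd.le
    · refine negSymmetric_of_sum_eq (N := n * (p + 1)) (w := w)
        (S := {w - 2 * p} + {-(w - 2 * p)}) (by simp only [Multiset.map_add, Multiset.map_singleton, neg_neg, add_comm]) ?_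
      have e : n * (p + 1) = (n + 1) + 1 + r := by linarith
      rw [show Multiset.replicate (n * (p + 1)) (-w) = Multiset.replicate (n + 1) (-w) +
        Multiset.replicate 1 (-w) + Multiset.replicate r (-w) by
          rw [e, Multiset.replicate_add, Multiset.replicate_add]]
      simp only [Fintype.sum_sum_type, Sum.elim_inl, Sum.elim_inr, Finset.sum_const,
        Finset.card_univ, Fintype.card_fin, Fintype.card_unit, one_smul,
        Multiset.replicate_one, Multiset.nsmul_singleton, Multiset.nsmul_replicate,
        mul_comm n (p + 1)]
      abel
    · rintro (i | i) <;> simp <;> omega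
    · rintro (i | i) <;> simp <;> linarith
    · rintro (i | i) <;> simp <;> linarith
    · simp [Fintype.sum_sum_type, hwn]; linear_combination (p : ℝ) * hrq
  · obtain ⟨r, hr⟩ := Nat.exists_eq_add_of_le h
    have hrq : (q : ℝ) = n * p + 2 + r := by exact_mod_cast hr
    have hwp : (p : ℝ) < w := by
      refine lt_of_mul_lt_mul_left ?_ hn'.le
      have : (0 : ℝ) ≤ r := Nat.cast_nonneg r
      linarith
    have key := exists_completion (ι := Fin (p + 1)) (κ := Unit ⊕ (Fin (n * p) ⊕ Fin r))
      (fun _ => Multiset.replicate n w)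
      (Sum.elim (fun _ => Multiset.replicate n (-w)) (Sum.elim (fun _ => {-w}) fun _ => 0)) ?_
      (Sum.elim (fun _ => n + 2) fun _ => n + 1)
      (Sum.elim (fun _ => -(q + 2 * p : ℝ)) fun _ => -(p : ℝ)) ?_ (D := 2 * p) (U := w - p)
      (C := w) ?_ ?_ (by linarith) (by linarith) (by linarith) ?_
    · obtain ⟨H, hsym, hcard, hsum, hmem⟩ := key
      refine ⟨_, inferInstance, _, ?_, hsym, ?_, ?_, Sum.inr (Sum.inl ()), by simp [hcard]⟩
      · simp; omega
      · rintro (i | i | i)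
        · simp [hwn]
        · simp [hcard, hsum]; ring
        · simp [hcard, hsum]
      · rintro (i | i) d hd
        · rw [Multiset.eq_of_mem_replicate hd, abs_of_pos hw0]
        · rcases hmem i d hd with hd | hd
          · have : d = -w := by
              rcases i with i | i | i
              · exact Multiset.eq_of_mem_replicate hd
              · exact Multiset.mem_singleton.1 hd
              · exact absurd hd (Multiset.notMem_zero d)
            rw [this, abs_neg, abs_of_pos hw0]
          · exact hd.le
    · refine negSymmetric_of_sum_eq (N := n * (p + 1)) (w := w) (S := 0) rfl ?_
      simp only [Fintype.sum_sum_type, Sum.elim_inl, Sum.elim_inr, Finset.sum_const,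
        Finset.card_univ, Fintype.card_fin, Fintype.card_unit, one_smul, smul_zero,
        ← Multiset.replicate_one, Multiset.nsmul_replicate, add_zero]
      rw [← Multiset.replicate_add]
      congr 2 <;> ring
    · rintro (i | i | i) <;> simp
      all_goals omega
    · rintro (i | i | i) <;> simp <;> linarith
    · rintro (i | i | i) <;> simp <;> linarith
    · simp [Fintype.sum_sum_type, hwn]; linear_combination (p : ℝ) * hrq

/-! ### Bounds on the smallest piece, and existence of an optimum -/

namespace MuffinSolution

variable {m s : ℕ}

theorem smallest_le (D : MuffinSolution m s) (i : Fin m) (j : Fin 2) : D.smallest ≤ D.size i j :=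
  ciInf_le (Set.finite_range fun p : Fin m × Fin 2 => D.size p.1 p.2).bddBelow (i, j)

theorem exists_size_eq_smallest (hm : 0 < m) (D : MuffinSolution m s) :
    ∃ i j, D.size i j = D.smallest := by
  have : Nonempty (Fin m × Fin 2) := ⟨(⟨0, hm⟩, 0)⟩
  obtain ⟨⟨i, j⟩, h⟩ := exists_eq_ciInf_of_finite (f := fun p : Fin m × Fin 2 => D.size p.1 p.2)
  exact ⟨i, j, h⟩

theorem smallest_pos (hm : 0 < m) (D : MuffinSolution m s) : 0 < D.smallest := by
  obtain ⟨i, j, h⟩ := D.exists_size_eq_smallest hm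
  exact h ▸ D.size_pos i j

theorem size_le_one_sub_smallest (D : MuffinSolution m s) (i : Fin m) (j : Fin 2) :
    D.size i j ≤ 1 - D.smallest := by
  have h := D.sum_muffin i
  rw [Fin.sum_univ_two] at h
  have h0 := D.smallest_le i 0
  have h1 := D.smallest_le i 1
  fin_cases j
  · simp only [Fin.zero_eta]; linarith
  · simp only [Fin.mk_one]; linarith

theorem numPieces_mul_eq (D : MuffinSolution m s) (k : Fin s) (c : ℝ) :
    (D.numPieces k : ℝ) * c = ∑ i, ∑ j, if D.student i j = k then c else 0 := by
  unfold numPieces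
  rw [← Fintype.sum_prod_type' (f := fun i j => if D.student i j = k then c else 0),
    ← Finset.sum_filter]
  simp

theorem numPieces_mul_smallest_le (D : MuffinSolution m s) (k : Fin s) :
    D.numPieces k * D.smallest ≤ (m : ℝ) / s := by
  rw [← D.sum_student k, numPieces_mul_eq]
  refine Finset.sum_le_sum fun i _ => Finset.sum_le_sum fun j _ => ?_
  split_ifs
  · exact D.smallest_le i j
  · exact le_rfl

theorem le_numPieces_mul (D : MuffinSolution m s) (k : Fin s) :
    (m : ℝ) / s ≤ D.numPieces k * (1 - D.smallest) := by
  rw [← D.sum_student k, numPieces_mul_eq]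
  refine Finset.sum_le_sum fun i _ => Finset.sum_le_sum fun j _ => ?_
  split_ifs
  · exact D.size_le_one_sub_smallest i j
  · exact le_rfl

theorem sum_numPieces (D : MuffinSolution m s) : ∑ k, D.numPieces k = 2 * m := by
  unfold numPieces
  rw [← Finset.card_eq_sum_card_fiberwise (fun _ _ => Finset.mem_univ _)]
  simp [mul_comm]

/-- A student with at most `v` pieces forces a piece of size at most `1 - x / v`. -/
theorem smallest_le_of_numPieces_le (hm : 0 < m) (D : MuffinSolution m s) {k : Fin s} {v : ℝ}
    (h : (D.numPieces k : ℝ) ≤ v) (hv : 0 < v) : D.smallest ≤ 1 - (m : ℝ) / s / v := by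
  have h0 := D.smallest_pos hm
  have h1 : 0 < 1 - D.smallest := by
    have h2 := (D.size_pos ⟨0, hm⟩ 0).trans_le (D.size_le_one_sub_smallest _ _)
    exact h2
  have h2 := D.le_numPieces_mul k
  have h3 := mul_le_mul_of_nonneg_right h h1.le
  have : (m : ℝ) / s / v ≤ 1 - D.smallest := by
    rw [div_le_iff₀ hv]; linarith
  linarith

/-- A student with at least `v` pieces has a piece of size at most `x / v`. -/
theorem smallest_le_of_le_numPieces (hm : 0 < m) (D : MuffinSolution m s) {k : Fin s} {v : ℝ}
    (h : v ≤ (D.numPieces k : ℝ)) (hv : 0 < v) : D.smallest ≤ (m : ℝ) / s / v := by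
  have h2 := D.numPieces_mul_smallest_le k
  have h3 := mul_le_mul_of_nonneg_right h (D.smallest_pos hm).le
  rw [le_div_iff₀ hv]; linarith

/-- If some solution is feasible for the fully-constrained problem, then that problem has an
optimal solution. -/
theorem exists_fullyOptimal (hm : 0 < m) {D₀ : MuffinSolution m s} (h₀ : D₀.FullyFeasible) :
    ∃ D : MuffinSolution m s, D.FullyOptimal := by
  have : Nonempty (Fin m × Fin 2) := ⟨(⟨0, hm⟩, 0)⟩
  -- Positivity of the pieces is not a closed condition. It is replaced by the positive lower bound
  -- `D₀.smallest`, which loses no solution at least as good as `D₀`.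
  let K : (Fin m → Fin 2 → Fin s) → Set (Fin m → Fin 2 → ℝ) := fun σ =>
    {z | (∀ i j, z i j ∈ Set.Icc D₀.smallest 1) ∧ (∀ i, ∑ j, z i j = 1) ∧
      ∀ k, (∑ i, ∑ j, if σ i j = k then z i j else 0) = (m : ℝ) / s}
  let S : Set (Fin m → Fin 2 → Fin s) :=
    {σ | ∀ k, (Finset.univ.filter fun p : Fin m × Fin 2 => σ p.1 p.2 = k).card =
        ⌊2 * ((m : ℝ) / (s : ℝ))⌋₊ ∨
      (Finset.univ.filter fun p : Fin m × Fin 2 => σ p.1 p.2 = k).card =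
        ⌊2 * ((m : ℝ) / (s : ℝ))⌋₊ + 1}
  have hK : ∀ σ, IsCompact (K σ) := by
    intro σ
    have h1 : IsCompact (Set.univ.pi fun _ : Fin m => Set.univ.pi fun _ : Fin 2 =>
        Set.Icc D₀.smallest 1) := isCompact_univ_pi fun _ => isCompact_univ_pi fun _ =>
          isCompact_Icc
    have h2 : IsClosed (⋂ i, {z : Fin m → Fin 2 → ℝ | ∑ j, z i j = 1}) :=
      isClosed_iInter fun i => isClosed_eq (by fun_prop) continuous_const
    have h3 : IsClosed (⋂ k, {z : Fin m → Fin 2 → ℝ |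
        (∑ i, ∑ j, if σ i j = k then z i j else 0) = (m : ℝ) / s}) := by
      refine isClosed_iInter fun k => isClosed_eq ?_ continuous_const
      refine continuous_finsetSum _ fun i _ => continuous_finsetSum _ fun j _ => ?_
      split_ifs <;> fun_prop
    convert (h1.inter_right h2).inter_right h3 using 1
    ext z
    simp only [K, Set.mem_ofPred_eq, Set.mem_inter_iff, Set.mem_iInter, Set.mem_univ_pi, and_assoc]
  have hsol : ∀ E : MuffinSolution m s, D₀.smallest ≤ E.smallest → E.size ∈ K E.student := by
    intro E hE
    refine ⟨fun i j => ⟨hE.trans (E.smallest_le i j), ?_⟩, E.sum_muffin, E.sum_student⟩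
    have := E.size_le_one_sub_smallest i j
    have := E.smallest_pos hm
    linarith
  let f : (Fin m → Fin 2 → ℝ) → ℝ := fun z => ⨅ p : Fin m × Fin 2, z p.1 p.2
  have hf : Continuous f := by
    have : f = fun z => Finset.univ.inf' Finset.univ_nonempty
        fun p : Fin m × Fin 2 => z p.1 p.2 := by
      funext z; exact (Finset.inf'_univ_eq_ciInf _).symm
    rw [this]
    exact Continuous.finset_inf'_apply _ fun p _ => by fun_prop
  obtain ⟨z, hz, hmax⟩ := ((Set.toFinite S).isCompact_biUnion fun σ _ => hK σ).exists_isMaxOn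
    ⟨D₀.size, Set.mem_biUnion (show D₀.student ∈ S from h₀) (hsol D₀ le_rfl)⟩ hf.continuousOn
  obtain ⟨σ, hσ, hzσ⟩ := Set.mem_iUnion₂.1 hz
  let D : MuffinSolution m s :=
    ⟨z, σ, fun i j => (D₀.smallest_pos hm).trans_le (hzσ.1 i j).1, hzσ.2.1, hzσ.2.2⟩
  have hle : ∀ E : MuffinSolution m s, E.FullyFeasible → D₀.smallest ≤ E.smallest →
      E.smallest ≤ D.smallest := fun E hE hE' =>
    hmax (Set.mem_biUnion (show E.student ∈ S from hE) (hsol E hE'))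
  refine ⟨D, hσ, fun E hE => ?_⟩
  rcases le_total D₀.smallest E.smallest with h | h
  · exact hle E hE h
  · exact h.trans (hle D₀ h₀ le_rfl)

end MuffinSolution

/-! ### Comparison of fully feasible solutions with all others -/

/-- A family of two groups gives a fully feasible muffin solution. -/
theorem HasTwoGroupFamily.exists_fullyFeasible {m s p q n : ℕ} {P : ℝ → Prop} (hs : 0 < s)
    (hfloor : ⌊2 * ((m : ℝ) / (s : ℝ))⌋₊ = n) (hpq : p + q = s) (hq : 2 * m = n * s + q)
    (h : HasTwoGroupFamily p q n (n + 1) P) (hP : ∀ d, P d → |d| < s) :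
    ∃ D : MuffinSolution m s, D.FullyFeasible ∧
      ∀ i j, ∃ d, P d ∧ D.size i j = 1 / 2 + d / (2 * s) := by
  obtain ⟨ι, _, F, hc, hsym, hF, hF'⟩ := h
  have hq' : 2 * (m : ℝ) = n * s + q := by exact_mod_cast hq
  have hpq' : (p : ℝ) + q = s := by exact_mod_cast hpq
  obtain ⟨D, e, hD, hsize⟩ := exists_muffinSolution hs (hc.trans hpq) F hsym
    (fun i => by rw [multiset_sum_eq_of_forall_mem hF i, hpq', hq']; ring)
    (fun i d hd => hP d (hF' i d hd))
  refine ⟨D, fun k => ?_, fun i j => ?_⟩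
  · rw [hfloor, hD]
    exact (hF (e k)).imp And.left And.left
  · obtain ⟨k, d, hd, h⟩ := hsize i j
    exact ⟨d, hF' k d hd, h⟩

theorem deviationBound_pos {p q n : ℕ} (hn : 2 ≤ n) (hp : 0 < p) : 0 < deviationBound p q n := by
  have hn' : (2 : ℝ) ≤ n := by exact_mod_cast hn
  have : (0 : ℝ) < n - 1 := by linarith
  exact lt_min (by positivity) (by positivity)

/-- Deviations below p + q = s in absolute value are what keeps the pieces positive. -/
theorem deviationBound_lt {p q n : ℕ} (hp : 0 < p) (hn : 2 ≤ n) :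
    deviationBound p q n < (p : ℝ) + q := by
  refine (min_le_left _ _).trans_lt ?_
  have hn' : (2 : ℝ) ≤ n := by exact_mod_cast hn
  have hp' : (0 : ℝ) < p := by exact_mod_cast hp
  have hq' : (0 : ℝ) ≤ q := Nat.cast_nonneg q
  rw [div_lt_iff₀ (by positivity)]
  nlinarith

theorem natCast_div_lt {p q n s : ℕ} (hn : 2 ≤ n) (hp : 0 < p) (hpq : p + q = s) :
    (q : ℝ) / n < s := by
  have hn' : (2 : ℝ) ≤ n := by exact_mod_cast hn
  have hp' : (0 : ℝ) < p := by exact_mod_cast hp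
  have hq0 : (0 : ℝ) ≤ q := Nat.cast_nonneg q
  have hpq' : (p : ℝ) + q = s := by exact_mod_cast hpq
  rw [div_lt_iff₀ (by positivity)]
  nlinarith

namespace MuffinSolution

variable {m s p q n : ℕ}

/-- Some student receives at most `n` pieces. -/
theorem smallest_le_of_floor (hs : 0 < s) (hm : 0 < m) (hn : 2 ≤ n) (hp : 0 < p)
    (hpq : p + q = s) (hq : 2 * m = n * s + q) (E : MuffinSolution m s) :
    E.smallest ≤ 1 / 2 - (q / n : ℝ) / (2 * s) := by
  obtain ⟨k, hk⟩ : ∃ k, E.numPieces k ≤ n := by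
    by_contra! h
    have h1 := E.sum_numPieces
    have h2 : ∑ _k : Fin s, (n + 1) ≤ ∑ k, E.numPieces k := Finset.sum_le_sum fun k _ => h k
    simp only [Finset.sum_const, Finset.card_univ, Fintype.card_fin, smul_eq_mul] at h2
    have : s * (n + 1) = n * s + s := by ring
    omega
  have hn' : (0 : ℝ) < n := by positivity
  have hs' : (0 : ℝ) < s := by exact_mod_cast hs
  have hq' : 2 * (m : ℝ) = n * s + q := by exact_mod_cast hq
  refine (E.smallest_le_of_numPieces_le hm (by exact_mod_cast hk) hn').trans (le_of_eq ?_)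
  have : (m : ℝ) = (n * s + q) / 2 := by linarith
  rw [this]; field_simp; ring

/-- A solution in which some student receives neither `n` nor `n + 1` pieces has a small piece. -/
theorem smallest_le_of_not_fullyFeasible (hs : 0 < s) (hm : 0 < m) (hn : 2 ≤ n)
    (hfloor : ⌊2 * ((m : ℝ) / (s : ℝ))⌋₊ = n) (hpq : p + q = s) (hq : 2 * m = n * s + q)
    (E : MuffinSolution m s) (hE : ¬ E.FullyFeasible) :
    E.smallest ≤ 1 / 2 - deviationBound p q n / (2 * s) := by
  have hn' : (2 : ℝ) ≤ n := by exact_mod_cast hn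
  have hs' : (0 : ℝ) < s := by exact_mod_cast hs
  have hq' : (m : ℝ) = (n * s + q) / 2 := by
    have : 2 * (m : ℝ) = n * s + q := by exact_mod_cast hq
    linarith
  have hpq' : (s : ℝ) = p + q := by exact_mod_cast hpq.symm
  unfold FullyFeasible at hE
  push Not at hE
  obtain ⟨k, hk1, hk2⟩ := hE
  rw [hfloor] at hk1 hk2
  rcases (by omega : E.numPieces k + 1 ≤ n ∨ n + 2 ≤ E.numPieces k) with hk | hk
  · have hn1 : (0 : ℝ) < n - 1 := by linarith
    have hk' : (E.numPieces k : ℝ) ≤ n - 1 := by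
      have : (E.numPieces k : ℝ) + 1 ≤ n := by exact_mod_cast hk
      linarith
    refine (E.smallest_le_of_numPieces_le hm hk' hn1).trans ?_
    have h1 : deviationBound p q n / (2 * s) ≤ (p + 2 * q) / (n - 1) / (2 * s) :=
      div_le_div_of_nonneg_right (min_le_right _ _) (by positivity)
    have h2 : 1 - (m : ℝ) / s / (n - 1) = 1 / 2 - (p + 2 * q) / (n - 1) / (2 * s) := by
      have : (p : ℝ) = s - q := by linarith
      rw [hq', this]; field_simp; ring
    linarith
  · refine (E.smallest_le_of_le_numPieces hm (v := n + 2) (by exact_mod_cast hk)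
      (by positivity)).trans ?_
    have h1 : deviationBound p q n / (2 * s) ≤ (2 * p + q) / (n + 2) / (2 * s) :=
      div_le_div_of_nonneg_right (min_le_left _ _) (by positivity)
    have h2 : (m : ℝ) / s / (n + 2) = 1 / 2 - (2 * p + q) / (n + 2) / (2 * s) := by
      have : (p : ℝ) = s - q := by linarith
      rw [hq', this]; field_simp; ring
    linarith

/-- Below the threshold, some fully feasible solution beats all other solutions. -/
theorem exists_fullyFeasible_lt (hs : 0 < s) (hm : 0 < m) (hn : 2 ≤ n)
    (hfloor : ⌊2 * ((m : ℝ) / (s : ℝ))⌋₊ = n) (hp : 0 < p) (hpq : p + q = s)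
    (hq : 2 * m = n * s + q) (hlt : q < n * p) :
    ∃ D : MuffinSolution m s, D.FullyFeasible ∧
      ∀ E : MuffinSolution m s, ¬ E.FullyFeasible → E.smallest < D.smallest := by
  have hs' : (0 : ℝ) < s := by exact_mod_cast hs
  have hfam : HasTwoGroupFamily p q n (n + 1) fun d => |d| < deviationBound p q n := by
    rcases Nat.eq_zero_or_pos q with rfl | hq0
    · exact hasTwoGroupFamily_zero (deviationBound_pos hn hp)
    · refine hasTwoGroupFamily_deviationBound hn hp hq0 hlt ?_
      rintro rfl
      exact ⟨m - s, by omega⟩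
  obtain ⟨D, hD, hsize⟩ := hfam.exists_fullyFeasible hs hfloor hpq hq fun d hd =>
    hd.trans ((deviationBound_lt hp hn).trans_eq (by exact_mod_cast hpq))
  refine ⟨D, hD, fun E hE => ?_⟩
  refine (E.smallest_le_of_not_fullyFeasible hs hm hn hfloor hpq hq hE).trans_lt ?_
  obtain ⟨i, j, hij⟩ := D.exists_size_eq_smallest hm
  obtain ⟨d, hd, h⟩ := hsize i j
  rw [← hij, h]
  have h1 := (abs_lt.1 hd).1
  have h2 : -deviationBound p q n / (2 * s) < d / (2 * s) :=
    div_lt_div_of_pos_right h1 (by positivity)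
  rw [neg_div] at h2
  linarith

theorem le_smallest_of_forall (hm : 0 < m) (hs : 0 < s) (D : MuffinSolution m s) {w : ℝ}
    (h : ∀ i j, ∃ d, |d| ≤ w ∧ D.size i j = 1 / 2 + d / (2 * s)) :
    1 / 2 - w / (2 * s) ≤ D.smallest := by
  have hs' : (0 : ℝ) < s := by exact_mod_cast hs
  obtain ⟨i, j, hij⟩ := D.exists_size_eq_smallest hm
  obtain ⟨d, hd, h⟩ := h i j
  rw [← hij, h]
  have h2 : -w / (2 * s) ≤ d / (2 * s) :=
    div_le_div_of_nonneg_right (abs_le.1 hd).1 (by positivity)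
  rw [neg_div] at h2
  linarith

/-- Above the threshold, some fully feasible solution is optimal. -/
theorem exists_fullyFeasible_supplyOptimal (hs : 0 < s) (hm : 0 < m) (hn : 2 ≤ n)
    (hfloor : ⌊2 * ((m : ℝ) / (s : ℝ))⌋₊ = n) (hp : 0 < p) (hpq : p + q = s)
    (hq : 2 * m = n * s + q) (hle : n * p ≤ q) :
    ∃ D : MuffinSolution m s, D.FullyFeasible ∧ D.SupplyOptimal := by
  have hq0 : 0 < q := (by positivity : 0 < n * p).trans_le hle
  have h1 : n * p + 2 * q ≤ (n + 1) * q := by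
    have : 2 * q ≤ n * q := Nat.mul_le_mul_right q hn
    linarith
  obtain ⟨D, hD, hsize⟩ := (hasTwoGroupFamily_of_le hp hq0 hn h1).exists_fullyFeasible hs hfloor
    hpq hq fun d hd => hd.trans_lt (natCast_div_lt hn hp hpq)
  exact ⟨D, hD, fun E => (E.smallest_le_of_floor hs hm hn hp hpq hq).trans
    (D.le_smallest_of_forall hm hs hsize)⟩

/-- Above the threshold, some solution that is not fully feasible is optimal. -/
theorem exists_not_fullyFeasible_supplyOptimal (hs : 0 < s) (hm : 0 < m) (hn : 2 ≤ n)
    (hfloor : ⌊2 * ((m : ℝ) / (s : ℝ))⌋₊ = n) (hp : 0 < p) (hpq : p + q = s)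
    (hq : 2 * m = n * s + q) (hle : n * p ≤ q) :
    ∃ D : MuffinSolution m s, D.SupplyOptimal ∧ ¬ D.FullyFeasible := by
  have hq' : 2 * (m : ℝ) = n * s + q := by exact_mod_cast hq
  have hpq' : (p : ℝ) + q = s := by exact_mod_cast hpq
  obtain ⟨ι, _, F, hc, hsym, hsum, hF, i₀, hi₀⟩ := exists_family_with_large_member hn hp hle (by
    rintro rfl
    exact ⟨m - s, by omega⟩)
  obtain ⟨D, e, hD, hsize⟩ := exists_muffinSolution hs (hc.trans hpq) F hsym
    (fun i => by rw [hsum, hpq', hq']; ring) (fun i d hd => (hF i d hd).trans_lt (natCast_div_lt hn hp hpq))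
  refine ⟨D, fun E => (E.smallest_le_of_floor hs hm hn hp hpq hq).trans
    (D.le_smallest_of_forall hm hs fun i j => ?_), fun h => ?_⟩
  · obtain ⟨k, d, hd, h⟩ := hsize i j
    exact ⟨d, hF k d hd, h⟩
  · have := h (e.symm i₀)
    rw [hD, e.apply_symm_apply, hi₀, hfloor] at this
    omega

end MuffinSolution

/-! ### The main theorem -/

theorem mainTheorem2 (m s n : ℕ) (hs : 0 < s) (hsm : s ≤ m)
    (hn : n = ⌊2 * ((m : ℝ) / (s : ℝ))⌋₊) :
    (∀ D : MuffinSolution m s, D.FullyOptimal → D.SupplyOptimal) ∧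
    (∃ D : MuffinSolution m s, D.SupplyOptimal ∧
      ∀ k, D.numPieces k = n ∨ D.numPieces k = n + 1) ∧
    ((∃ D : MuffinSolution m s, D.SupplyOptimal ∧ ¬ D.FullyFeasible) ↔
      ((n : ℝ) * ((n : ℝ) + 2) / (2 * ((n : ℝ) + 1)) ≤ (m : ℝ) / (s : ℝ) ∧
        (m : ℝ) / (s : ℝ) < ((n : ℝ) + 1) / 2)) := by
  have hm : 0 < m := hs.trans_le hsm
  have hs' : (0 : ℝ) < s := by exact_mod_cast hs
  have hx0 : (0 : ℝ) ≤ 2 * ((m : ℝ) / s) := by positivity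
  have h1 : n * s ≤ 2 * m := by
    have h : (n : ℝ) ≤ 2 * ((m : ℝ) / s) := hn ▸ Nat.floor_le hx0
    rw [← mul_div_assoc, le_div_iff₀ hs'] at h
    exact_mod_cast h
  have h2' : (2 : ℝ) * (m / s) < n + 1 := by
    rw [hn]; exact Nat.lt_floor_add_one _
  have h2 : 2 * m < (n + 1) * s := by
    have h := h2'
    rw [← mul_div_assoc, div_lt_iff₀ hs'] at h
    exact_mod_cast h
  have hn2 : 2 ≤ n := by
    by_contra! h
    have : (n + 1) * s ≤ 2 * s := Nat.mul_le_mul_right s (by omega)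
    omega
  obtain ⟨q, hq⟩ := Nat.exists_eq_add_of_le h1
  obtain ⟨p, hp, hpq⟩ : ∃ p, 0 < p ∧ p + q = s := by
    have : (n + 1) * s = n * s + s := by ring
    exact ⟨s - q, by omega, by omega⟩
  have hcond : ((n : ℝ) * (n + 2) / (2 * (n + 1)) ≤ (m : ℝ) / s ∧
      (m : ℝ) / s < ((n : ℝ) + 1) / 2) ↔ n * p ≤ q := by
    have hq' : 2 * (m : ℝ) = n * s + q := by exact_mod_cast hq
    have hpq' : (p : ℝ) + q = s := by exact_mod_cast hpq
    -- The upper bound on x holds automatically, by the definition of the floor; only the lower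
    -- bound carries information.
    rw [and_iff_left (by linarith), div_le_div_iff₀ (by positivity) hs', ← Nat.cast_le (α := ℝ)]
    push_cast
    have e : (n : ℝ) * (n + 2) * s - m * (2 * (n + 1)) = n * p - q := by
      linear_combination (-(n : ℝ) - 1) * hq' - (n : ℝ) * hpq'
    constructor <;> intro h <;> linarith
  rw [hcond]
  rcases lt_or_ge q (n * p) with hlt | hle
  · obtain ⟨D₀, hD₀, hbest⟩ :=
      MuffinSolution.exists_fullyFeasible_lt hs hm hn2 hn.symm hp hpq hq hlt
    have hopt : ∀ D : MuffinSolution m s, D.FullyOptimal → D.SupplyOptimal := by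
      intro D hD E
      by_cases hE : E.FullyFeasible
      · exact hD.2 E hE
      · exact (hbest E hE).le.trans (hD.2 D₀ hD₀)
    refine ⟨hopt, ?_, ?_⟩
    -- `D₀` only beats the solutions that are not fully feasible, so an optimum among the fully
    -- feasible ones has to come from compactness.
    · obtain ⟨D, hD⟩ := MuffinSolution.exists_fullyOptimal hm hD₀
      exact ⟨D, hopt D hD, by rw [hn]; exact hD.1⟩
    · refine iff_of_false ?_ hlt.not_ge
      rintro ⟨D, hD, hD'⟩
      exact ((hbest D hD').trans_le (hD D₀)).false
  · obtain ⟨D₀, hD₀, hopt⟩ :=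
      MuffinSolution.exists_fullyFeasible_supplyOptimal hs hm hn2 hn.symm hp hpq hq hle
    refine ⟨fun D hD E => (hopt E).trans (hD.2 D₀ hD₀), ⟨D₀, hopt, by rw [hn]; exact hD₀⟩,
      iff_of_true ?_ hle⟩
    exact MuffinSolution.exists_not_fullyFeasible_supplyOptimal hs hm hn2 hn.symm hp hpq hq hle
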